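/- Let $p \neq r$ be primes, let $k$ be an algebraically closed field of characteristic $r$, and let $G$ be a finite group with a split $BN$-pair $(B,N)$ of characteristic $p$ (for example, a finite group of Lie type in characteristic $p$): $G=\langle B,N\rangle$; $T=B\cap N$ is normal in $N$; $W=N/T$ is generated by a set $S$ of involutions such that $n_sBn_s\neq B$ and $n_sBn\subseteq Bn_snB\cup BnB$ for all $s \in S$, all representatives $n_s \in N$ of $s$ and all $n\in N$; $B=U\rtimes T$, where $U$ is the largest normal $p$-subgroup of $B$; $\bigcap_{n\in N}nBn^{-1}=T$; and $T$ is abelian. All modules are finite-dimensional left modules. For a one-dimensional $kT$-module $X$, let $R_T^G(X)=\mathrm{Ind}_B^G(\tilde X)$, where $\tilde X$ is the inflation of $X$ along $B\to B/U\cong T$. The principal series $\mathrm{Irr}_k(G|(T,X))$ consists of the irreducible $kG$-modules $Y$ such that $T$ is minimal among the Levi subgroups $L$ (the $N$-conjugates of the standard Levi subgroups $L_J$, $J\subseteq S$) with ${}^*R^G_L(Y)\neq 0$ and $X$ is a composition factor of the $kT$-module ${}^*R_T^G(Y)=Y^U$; here ${}^*R^G_L(Y)$ is the space of fixed points on $Y$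 of the largest normal $p$-subgroup of a parabolic subgroup with Levi complement $L$. Let $Y \in \mathrm{Irr}_k(G|(T,X))$, and let $Z$ be an irreducible $kG$-module with $Z\notin \mathrm{Irr}_k(G|(T,X))$. Then $\mathrm{Ext}^1_{kG}(R_T^G(X),Z)=0$; there is a (necessarily maximal) submodule $\mathscr L^0$ of $R_T^G(X)$ with $R_T^G(X)/\mathscr L^0\cong Y$; and for every such $\mathscr L^0$ the space $\mathrm{Ext}^1_{kG}(Y,Z)$ is finite-dimensional with $$\dim_k \mathrm{Ext}^1_{kG}(Y,Z)=[\mathrm{head}(\mathscr L^0):Z],$$ the multiplicity of $Z$ as a composition factor of $\mathrm{head}(\mathscr L^0)$, the quotient of $\mathscr L^0$ by the intersection of its maximal submodules. -/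

import Mathlib

open scoped MonoidAlgebra

universe u v

noncomputable section

/-! ### Split BN-pairs -/

/-- `O_p(P)`, the largest normal `p`-subgroup of `P` (`P` finite), as a join of all of them. -/
def pCore (p : ℕ) (P : Type v) [Group P] : Subgroup P :=
  sSup {K : Subgroup P | K.Normal ∧ IsPGroup p K}

instance pCore_normal (p : ℕ) (P : Type v) [Group P] : (pCore p P).Normal := by
  refine ⟨fun n hn g => ?_⟩
  have key : pCore p P ≤ (pCore p P).comap (MulAut.conj g).toMonoidHom :=
    sSup_le fun K hK x hx => (le_sSup hK : K ≤ pCore p P) (hK.1.conj_mem x hx g)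
  exact key hn

/-- The conjugate `g H g⁻¹`. -/
def conjSubgroup {G : Type v} [Group G] (g : G) (H : Subgroup G) : Subgroup G :=
  H.map (MulAut.conj g).toMonoidHom

/-- A split `BN`-pair of characteristic `p` on a group `G`, with torus `T = B ∩ N`, Weyl group
`W = N / T`, and set `S ⊆ W` of distinguished generators. -/
structure SplitBNPair (p : ℕ) (G : Type v) [Group G] where
  /-- the Borel subgroup -/
  B : Subgroup G
  /-- the subgroup covering the Weyl group -/
  N : Subgroup G
  /-- `G` is generated by `B` and `N` -/
  sup_eq_top : B ⊔ N = ⊤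
  /-- `T = B ∩ N` is normal in `N` -/
  [torus_normal : ((B ⊓ N).subgroupOf N).Normal]
  /-- the distinguished generators of the Weyl group -/
  S : Set (N ⧸ (B ⊓ N).subgroupOf N)
  /-- `W` is generated by `S` -/
  closure_S : Subgroup.closure S = ⊤
  /-- the elements of `S` are involutions (`s ≠ 1` follows from `conj_ne`) -/
  sq_eq_one : ∀ s ∈ S, s * s = 1
  /-- `n_s B n_s ≠ B` for every representative `n_s` of every `s ∈ S` -/
  conj_ne : ∀ n : N, (n : N ⧸ (B ⊓ N).subgroupOf N) ∈ S →
    (fun b : G => (n : G) * b * n) '' (B : Set G) ≠ B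
  /-- `n_s B n ⊆ B n_s n B ∪ B n B` for every representative `n_s` of every `s ∈ S` and `n ∈ N` -/
  mul_subset : ∀ m n : N, (m : N ⧸ (B ⊓ N).subgroupOf N) ∈ S → ∀ b ∈ B,
    (m : G) * b * n ∈
      DoubleCoset.doubleCoset ((m : G) * n) (B : Set G) B ∪
        DoubleCoset.doubleCoset (n : G) (B : Set G) B
  /-- `B = U ⋊ T` with `U = O_p(B)` (in particular the order of `T` is prime to `p`) -/
  split : Subgroup.IsComplement' ((B ⊓ N).subgroupOf B) (pCore p B)
  /-- `⋂_{n ∈ N} n B n⁻¹ = T` -/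
  iInf_conj : ⨅ n : N, conjSubgroup (n : G) B = B ⊓ N
  /-- `T` is abelian -/
  torus_comm : ∀ s ∈ B ⊓ N, ∀ t ∈ B ⊓ N, s * t = t * s

namespace SplitBNPair

variable {p : ℕ} {G : Type v} [Group G] (D : SplitBNPair p G)

/-- The torus `T = B ∩ N`. -/
def T : Subgroup G := D.B ⊓ D.N

lemma T_le_B : D.T ≤ D.B := inf_le_left

/-- The Weyl group `W = N / T`. -/
abbrev W : Type v := D.N ⧸ (D.B ⊓ D.N).subgroupOf D.N

/-- The subgroup generated by `C` and all representatives in `N` of the elements of `J ⊆ W`. -/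
def genOver (C : Subgroup G) (J : Set D.W) : Subgroup G :=
  C ⊔ Subgroup.closure {g : G | ∃ n : D.N, (n : D.W) ∈ J ∧ (n : G) = g}

/-- `n₀ ∈ N` represents the longest element of `W`, that is, `n₀ B n₀⁻¹` is the Borel subgroup
opposite to `B`. -/
def IsOpposite (n₀ : G) : Prop :=
  n₀ ∈ D.N ∧ D.B ⊓ conjSubgroup n₀ D.B = D.T

/-- The standard parabolic subgroup `P_J = ⟨B, n_s (s ∈ J)⟩`. -/
def parabolic (J : Set D.W) : Subgroup G := D.genOver D.B J

/-- The standard Levi subgroup `L_J` of `P_J`: the intersection of `P_J` with the opposite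
parabolic subgroup `⟨n₀ B n₀⁻¹, n_s (s ∈ J)⟩`. -/
def levi (n₀ : G) (J : Set D.W) : Subgroup G :=
  D.parabolic J ⊓ D.genOver (conjSubgroup n₀ D.B) J

/-- The pairs `(P, L) = (ⁿP_J, ⁿL_J)` with `J ⊆ S` and `n ∈ N`. -/
def IsLeviPair (P L : Subgroup G) : Prop :=
  ∃ J ⊆ D.S, ∃ n₀, D.IsOpposite n₀ ∧ ∃ n ∈ D.N,
    P = conjSubgroup n (D.parabolic J) ∧ L = conjSubgroup n (D.levi n₀ J)

end SplitBNPair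

/-! ### Harish-Chandra induction and restriction -/

section HarishChandra

variable {G : Type v} [Group G] {k : Type u} [Field k]

/-- The projection `P → L` with kernel `O_p(P)`, if `P = O_p(P) ⋊ L`. -/
def leviProj (p : ℕ) (P L : Subgroup G) (hL : L ≤ P)
    (h : Subgroup.IsComplement' (L.subgroupOf P) (pCore p P)) : P →* L :=
  ((Subgroup.subgroupOfEquivOfLe hL).toMonoidHom.comp h.QuotientMulEquiv.toMonoidHom).comp
    (QuotientGroup.mk' (pCore p P))

/-- Harish-Chandra induction `R_{L ⊆ P}^G(X)`: inflate `X` from `L` to `P = O_p(P) ⋊ L`, then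
induce to `G`. -/
def hcInd (p : ℕ) (P L : Subgroup G) (hL : L ≤ P)
    (h : Subgroup.IsComplement' (L.subgroupOf P) (pCore p P))
    {V : Type*} [AddCommGroup V] [Module k V] (X : Representation k L V) :
    Representation k G
      (Representation.IndV P.subtype (X.comp (leviProj p P L hL h))) :=
  Representation.ind P.subtype (X.comp (leviProj p P L hL h))

/-- The subspace `Y^{O_p(P)}`. -/
abbrev hcFixed (p : ℕ) (P : Subgroup G) {V : Type*} [AddCommGroup V] [Module k V]
    (Y : Representation k G V) : Submodule k V :=
  Representation.invariants ((Y.comp P.subtype).comp (pCore p P).subtype)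

/-- Harish-Chandra restriction `*R_{L ⊆ P}^G(Y)`: the space `Y^{O_p(P)}` with the action of `L`. -/
def hcRes (p : ℕ) (P L : Subgroup G) (hL : L ≤ P) {V : Type*} [AddCommGroup V] [Module k V]
    (Y : Representation k G V) : Representation k L (hcFixed p P Y) :=
  (Representation.toInvariants (Y.comp P.subtype) (pCore p P)).comp (Subgroup.inclusion hL)

end HarishChandra

/-! ### Composition factors and heads -/

section Modules

variable (A : Type*) [Ring A] (M : Type*) [AddCommGroup M] [Module A M]
  (Z : Type*) [AddCommGroup Z] [Module A Z]

/-- The simple module `Z` is a composition factor of `M`: it is isomorphic to `M₂ / M₁` for some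
submodules `M₁ ≤ M₂` of `M`. -/
def IsCompositionFactor : Prop :=
  IsSimpleModule A Z ∧ ∃ M₁ M₂ : Submodule A M, M₁ ≤ M₂ ∧
    Nonempty ((M₂ ⧸ M₁.submoduleOf M₂) ≃ₗ[A] Z)

/-- `[M : Z]`, the number of factors isomorphic to `Z` in a composition series
`0 = M₀ ⋖ M₁ ⋖ ⋯ ⋖ Mₗ = M` of a module `M` of finite length (and `0` if there is no such
series). -/
def compositionMultiplicity : ℕ :=
  open Classical in
  if h : ∃ s : CompositionSeries (Submodule A M), s.head = ⊥ ∧ s.last = ⊤ then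
    Nat.card {i : Fin h.choose.length //
      Nonempty ((h.choose i.succ ⧸
        (h.choose i.castSucc).submoduleOf (h.choose i.succ)) ≃ₗ[A] Z)}
  else 0

/-- The head of `M`: its quotient by the intersection of all maximal submodules. -/
abbrev ModuleHead : Type _ := M ⧸ Module.jacobson A M

end Modules

/-! ### Harish-Chandra series -/

namespace SplitBNPair

variable {p : ℕ} {G : Type v} [Group G] (D : SplitBNPair p G) {k : Type u} [Field k]

/-- `Y ∈ Irr_k(G | (L, X))`, where `L` is a Levi complement in `P`: `Y` is irreducible, `L` is
minimal among the Levi subgroups of `G` with `*R_L^G(Y) ≠ 0`, and `X` is a composition factor of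
`*R_L^G(Y)`. -/
def InSeries (P L : Subgroup G) (hL : L ≤ P)
    {VX : Type*} [AddCommGroup VX] [Module k VX] (X : Representation k L VX)
    {VY : Type*} [AddCommGroup VY] [Module k VY] (Y : Representation k G VY) : Prop :=
  Y.IsIrreducible ∧ hcFixed p P Y ≠ ⊥ ∧
    (∀ P' L' : Subgroup G, D.IsLeviPair P' L' → L' < L → hcFixed p P' Y = ⊥) ∧
    IsCompositionFactor k[L] (hcRes p P L hL Y).asModule X.asModule

/-- `Y` belongs to the principal series `Irr_k(G | (T, X))`. -/
def InPrincipalSeries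
    {VX : Type*} [AddCommGroup VX] [Module k VX] (X : Representation k D.T VX)
    {VY : Type*} [AddCommGroup VY] [Module k VY] (Y : Representation k G VY) : Prop :=
  D.InSeries D.B D.T D.T_le_B X Y

/-- The Harish-Chandra induced module `R_T^G(X) = Ind_B^G(X̃)`, as a `kG`-module. -/
abbrev R {VX : Type*} [AddCommGroup VX] [Module k VX] (X : Representation k D.T VX) : Type _ :=
  (hcInd p D.B D.T D.T_le_B D.split X).asModule

end SplitBNPair

/-- `Ext¹_{kG}(M, M')`, a vector space over `k`. -/
abbrev ExtOne (k : Type u) [Field k] (G : Type v) [Group G] (M M' : Type (max u v))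
    [AddCommGroup M] [Module k[G] M] [AddCommGroup M'] [Module k[G] M'] : Type (max u v) :=
  CategoryTheory.Abelian.Ext (ModuleCat.of k[G] M) (ModuleCat.of k[G] M') 1

end

universe w

noncomputable section


/-! ### Homomorphisms from a semisimple module to a simple module -/

section SemisimpleHom

/-! Let U = O_p(B). Its order is invertible in k, so averaging over U projects every kG-module onto
its U-fixed points. The order of T may be divisible by r, so kT need not be semisimple;
commutativity of kT takes the place of semisimplicity. Every Levi subgroup contains T, so Z lies
outside the series exactly because X is not a composition factor of Z^U
(`inPrincipalSeries_of_isCompositionFactor`). Nakayama then gives a ∈ kT acting as 1 on X and as 0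
on Z^U (`exists_annihilator_of_not_isCompositionFactor`). Frobenius reciprocity gives Hom(R(X), Z) =
0 (`hcInd_linearMap_eq_zero`). In an extension of R(X) by Z, lift the generating copy of X linearly,
average over U and apply a: the failure of T-equivariance lies in Z^U, where a kills it, so the
extension splits (`exists_extend_of_ker_hcInd`) and Ext¹(R(X), Z) = 0. Over a commutative artinian
ring the composition factor X of Y^U embeds in Y^U, so Y is a quotient of R(X)
(`exists_surjective_R`). The long exact sequence of 0 → L⁰ → R(X) → Y → 0 now identifies Hom(L⁰, Z)
with Ext¹(Y, Z) (`nonempty_linearMap_ker_equiv_ext_one`), and Schur's lemma computes the dimension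
of the former (`compositionMultiplicity_moduleHead`). -/

lemma Fin.last_eq_sum_of_succ_eq_add {n : ℕ} (a : Fin (n + 1) → ℕ) (d : Fin n → ℕ)
    (h0 : a 0 = 0) (h : ∀ i : Fin n, a i.succ = a i.castSucc + d i) :
    a (Fin.last n) = ∑ i, d i := by
  induction n with
  | zero => simpa using h0
  | succ n ih =>
    rw [Fin.sum_univ_castSucc, ← Fin.succ_last, h,
      ← ih (fun i => a i.castSucc) (fun i => d i.castSucc) h0 fun i => h i.castSucc]

variable (k : Type*) [Field k] {A : Type*} [Ring A] [Algebra k A]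
  {M : Type*} [AddCommGroup M] [Module A M] [Module k M] [IsScalarTower k A M]
  {Z : Type*} [AddCommGroup Z] [Module A Z] [Module k Z] [IsScalarTower k A Z]

instance finiteDimensional_linearMap [FiniteDimensional k M] [FiniteDimensional k Z] :
    FiniteDimensional k (M →ₗ[A] Z) :=
  .of_injective (LinearMap.restrictScalarsₗ k A M Z k) (LinearMap.restrictScalars_injective _)

lemma finiteDimensional_submodule [FiniteDimensional k M] (N : Submodule A M) :
    FiniteDimensional k N :=
  .of_injective (N.subtype.restrictScalars k) N.subtype_injective

open Classical in
/-- Schur's lemma for homomorphisms between two simple modules. -/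
lemma finrank_linearMap_of_isSimpleModule [IsAlgClosed k] (M : Type*) [AddCommGroup M] [Module A M]
    [FiniteDimensional k Z] [IsSimpleModule A M] [IsSimpleModule A Z] :
    Module.finrank k (M →ₗ[A] Z) = if Nonempty (M ≃ₗ[A] Z) then 1 else 0 := by
  split_ifs with h
  · obtain ⟨e⟩ := h
    rw [(LinearEquiv.congrLeft Z k e).finrank_eq]
    have e' := LinearEquiv.ofBijective (Algebra.linearMap k (Module.End A Z))
      (IsSimpleModule.algebraMap_end_bijective_of_isAlgClosed k)
    rw [← e'.finrank_eq, Module.finrank_self]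
  · have : Subsingleton (M →ₗ[A] Z) := by
      refine subsingleton_of_forall_eq 0 fun f => ?_
      refine f.bijective_or_eq_zero.resolve_left fun hf => h ⟨LinearEquiv.ofBijective f hf⟩
    exact Module.finrank_zero_of_subsingleton

/-- A complement of `N` exists by semisimplicity, and Hom(-, Z) turns the direct sum into a product.
-/
lemma finrank_linearMap_eq_add [IsSemisimpleModule A M] [FiniteDimensional k M]
    [FiniteDimensional k Z] (N : Submodule A M) :
    Module.finrank k (M →ₗ[A] Z) =
      Module.finrank k (N →ₗ[A] Z) + Module.finrank k ((M ⧸ N) →ₗ[A] Z) := by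
  obtain ⟨C, hC⟩ := exists_isCompl N
  rw [← (LinearEquiv.congrLeft Z k (Submodule.prodEquivOfIsCompl N C hC)).finrank_eq,
    ← (LinearMap.coprodEquiv k).finrank_eq, Module.finrank_prod,
    (LinearEquiv.congrLeft Z k (Submodule.quotientEquivOfIsCompl N C hC)).finrank_eq]

/-- For `M` semisimple and `Z` simple, `[M : Z] = dim Hom(M, Z)`. -/
theorem compositionMultiplicity_eq_finrank [IsAlgClosed k] [IsSemisimpleModule A M]
    [FiniteDimensional k M] [FiniteDimensional k Z] [IsSimpleModule A Z] :
    compositionMultiplicity A M Z = Module.finrank k (M →ₗ[A] Z) := by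
  classical
  have hN : IsNoetherian A M := isNoetherian_of_tower k inferInstance
  have hA : IsArtinian A M := isArtinian_of_tower k inferInstance
  have h : ∃ s : CompositionSeries (Submodule A M), s.head = ⊥ ∧ s.last = ⊤ :=
    isFiniteLength_iff_exists_compositionSeries.mp
      (isFiniteLength_iff_isNoetherian_isArtinian.mpr ⟨hN, hA⟩)
  rw [compositionMultiplicity, dif_pos h]
  obtain ⟨h0, h1⟩ := h.choose_spec
  -- Only the two end terms matter, so the count is valid for any series and Jordan–Hölder is not
  -- needed.
  generalize h.choose = s at *
  rw [← (LinearEquiv.congrLeft Z k (LinearEquiv.ofTop _ h1)).finrank_eq]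
  -- Along the series dim Hom(s i, Z) grows by 1 exactly at the factors isomorphic to Z.
  refine Eq.trans ?_ (Fin.last_eq_sum_of_succ_eq_add
    (fun i => Module.finrank k (s i →ₗ[A] Z)) (fun i => if Nonempty ((s i.succ ⧸
      (s i.castSucc).submoduleOf (s i.succ)) ≃ₗ[A] Z) then 1 else 0) ?_ fun i => ?_).symm
  · rw [Nat.card_eq_fintype_card, Fintype.card_subtype, Finset.card_filter]
  · have : Subsingleton (s 0) := by
      change Subsingleton s.head
      rw [h0]; infer_instance
    have : Subsingleton (s 0 →ₗ[A] Z) := ⟨fun f g => LinearMap.ext fun x => by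
      rw [Subsingleton.elim x 0, map_zero, map_zero]⟩
    exact Module.finrank_zero_of_subsingleton
  · have cov := s.step i
    have : IsSimpleModule A (s i.succ ⧸ (s i.castSucc).submoduleOf (s i.succ)) :=
      (covBy_iff_quot_is_simple cov.le).mp cov
    have := finiteDimensional_submodule k (s i.succ)
    dsimp only
    rw [finrank_linearMap_eq_add k ((s i.castSucc).submoduleOf (s i.succ)),
      finrank_linearMap_of_isSimpleModule k (s i.succ ⧸ (s i.castSucc).submoduleOf (s i.succ))]
    congr 1
    exact (LinearEquiv.congrLeft Z k (Submodule.submoduleOfEquivOfLe cov.le)).finrank_eq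

/-- For `Z` simple, `[head(M) : Z] = dim Hom(M, Z)`. -/
theorem compositionMultiplicity_moduleHead [IsAlgClosed k]
    [FiniteDimensional k M] [FiniteDimensional k Z] [IsSimpleModule A Z] :
    compositionMultiplicity A (ModuleHead A M) Z = Module.finrank k (M →ₗ[A] Z) := by
  have : IsArtinian A M := isArtinian_of_tower k inferInstance
  have : IsSemisimpleModule A (ModuleHead A M) :=
    (IsArtinian.isSemisimpleModule_iff_jacobson A _).mpr (Module.jacobson_quotient_jacobson A M)
  rw [compositionMultiplicity_eq_finrank k]
  let φ : (ModuleHead A M →ₗ[A] Z) →ₗ[k] (M →ₗ[A] Z) :=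
    LinearMap.lcomp k Z (Module.jacobson A M).mkQ
  refine (LinearEquiv.ofBijective φ ⟨fun f g hfg => ?_, fun f => ?_⟩).finrank_eq
  · exact Submodule.linearMap_qext _ hfg
  · have hle : Module.jacobson A M ≤ LinearMap.ker f := by
      have := Module.le_comap_jacobson f
      rwa [IsSemisimpleModule.jacobson_eq_bot A Z] at this
    exact ⟨(Module.jacobson A M).liftQ f hle, Submodule.liftQ_mkQ _ f hle⟩

end SemisimpleHom

/-! ### Composition factors over commutative rings -/

section Commutative

variable {A : Type*} [CommRing A] {M : Type*} [AddCommGroup M] [Module A M]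
  {X : Type*} [AddCommGroup X] [Module A X]

/-- Write X ≅ A/I with I maximal. If IM ≠ M, a maximal submodule above IM has quotient A/I ≅ X,
making X a composition factor. Hence IM = M, and Nakayama yields a ≡ 1 mod I with aM = 0. -/
lemma exists_annihilator_of_not_isCompositionFactor
    [Module.Finite A M] [IsSimpleModule A X] (h : ¬ IsCompositionFactor A M X) :
    ∃ a : A, (∀ m : M, a • m = 0) ∧ ∀ x : X, a • x = x := by
  obtain ⟨I, hI, ⟨e⟩⟩ := isSimpleModule_iff_quot_maximal.mp ‹IsSimpleModule A X›
  have hIX : ∀ a ∈ I, ∀ x : X, a • x = 0 := fun a ha x => by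
    apply e.injective
    obtain ⟨y, hy⟩ := Ideal.Quotient.mk_surjective (e x)
    rw [map_smul, ← hy, map_zero]
    exact Ideal.Quotient.eq_zero_iff_mem.mpr (I.mul_mem_right _ ha)
  have htop : (I • ⊤ : Submodule A M) = ⊤ := by
    by_contra hne
    obtain ⟨N, hN, hle⟩ := (eq_top_or_exists_le_coatom (I • ⊤ : Submodule A M)).resolve_left hne
    have : IsSimpleModule A (M ⧸ N) := isSimpleModule_iff_isCoatom.mpr hN
    obtain ⟨J, hJ, ⟨e'⟩⟩ := isSimpleModule_iff_quot_maximal.mp this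
    have hIJ : I ≤ J := fun a ha => by
      obtain ⟨y, hy⟩ := N.mkQ_surjective (e'.symm 1)
      have h1 : e' (N.mkQ (a • y)) = 0 := by
        have : a • y ∈ N := hle (Submodule.smul_mem_smul ha trivial)
        rw [N.mkQ_apply, (Submodule.Quotient.mk_eq_zero N).mpr this, map_zero]
      rw [map_smul, hy, map_smul, e'.apply_symm_apply] at h1
      have h2 : Ideal.Quotient.mk J a = 0 := by
        rw [← h1, Algebra.smul_def, mul_one]; rfl
      exact Ideal.Quotient.eq_zero_iff_mem.mp h2
    obtain rfl := hI.eq_of_le hJ.ne_top hIJ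
    refine h ⟨‹_›, N, ⊤, le_top, ⟨?_⟩⟩
    refine (Submodule.Quotient.equiv _ N (Submodule.topEquiv (R := A) (M := M)) ?_).trans
      (e'.trans e.symm)
    ext x
    simp [Submodule.submoduleOf]
  obtain ⟨a, ha, ha'⟩ := Submodule.exists_sub_one_mem_and_smul_eq_zero_of_fg_of_le_smul I ⊤
    (Module.Finite.fg_top (R := A) (M := M)) htop.ge
  refine ⟨a, fun m => ha' m trivial, fun x => ?_⟩
  have := hIX _ ha x
  rwa [sub_smul, one_smul, sub_eq_zero] at this

/-- With X ≅ A/I, the ideal I contains the annihilator of M and is minimal over it, since primes of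
an artinian ring are maximal. Minimal primes over the annihilator are associated primes, so A/I
embeds in M. -/
lemma exists_linearMap_injective_of_isCompositionFactor
    [IsArtinianRing A] [Module.Finite A M] (h : IsCompositionFactor A M X) :
    ∃ f : X →ₗ[A] M, Function.Injective f := by
  obtain ⟨hX, M₁, M₂, hle, ⟨e₀⟩⟩ := h
  obtain ⟨I, hI, ⟨e⟩⟩ := isSimpleModule_iff_quot_maximal.mp hX
  have hann : Module.annihilator A M ≤ I := fun a ha => by
    obtain ⟨y, hy⟩ := Submodule.mkQ_surjective _ (e₀.symm (e.symm 1))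
    have h1 : a • y = 0 := Subtype.ext (Module.mem_annihilator.mp ha _)
    have h2 : a • (1 : A ⧸ I) = 0 := by
      rw [← e.apply_symm_apply 1, ← e₀.apply_symm_apply (e.symm 1), ← hy, ← map_smul, ← map_smul,
        ← map_smul, h1, map_zero, map_zero, map_zero]
    have h2 : Ideal.Quotient.mk I a = 0 := by
      rw [← h2, Algebra.smul_def, mul_one]; rfl
    exact Ideal.Quotient.eq_zero_iff_mem.mp h2
  have hmin : I ∈ (Module.annihilator A M).minimalPrimes := by
    refine ⟨⟨hI.isPrime, hann⟩, fun J hJ hJI => ?_⟩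
    have := hJ.1
    exact ((IsArtinianRing.isMaximal_of_isPrime J).eq_of_le hI.ne_top hJI).ge
  obtain ⟨-, x, hx⟩ := isAssociatedPrime_iff.mp
    (Module.associatedPrimes.minimalPrimes_annihilator_subset_associatedPrimes A M hmin)
  have hker : I = LinearMap.ker (LinearMap.toSpanSingleton A M x) := by
    ext a
    rw [hx]
    simp [Submodule.mem_colon_singleton]
  refine ⟨I.liftQ (LinearMap.toSpanSingleton A M x) hker.le ∘ₗ e.toLinearMap, ?_⟩
  rw [LinearMap.coe_comp]
  refine Function.Injective.comp (LinearMap.ker_eq_bot.mp ?_) e.injective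
  exact Submodule.ker_liftQ_eq_bot _ _ _ hker.ge

end Commutative


/-! ### The largest normal `p`-subgroup -/

section PCore

/-- Normality is carried through the induction because the join of two p-subgroups is known to be a
p-group only when one of them is normal. -/
lemma isPGroup_pCore (p : ℕ) (P : Type*) [Group P] [Finite P] : IsPGroup p (pCore p P) := by
  suffices h : ∀ s : Set (Subgroup P), s.Finite → (∀ K ∈ s, K.Normal ∧ IsPGroup p K) →
      (sSup s).Normal ∧ IsPGroup p (sSup s : Subgroup P) from
    (h _ (Set.toFinite _) fun _ hK => hK).2
  intro s hs
  induction s, hs using Set.Finite.induction_on with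
  | empty =>
    intro _
    rw [sSup_empty]
    exact ⟨inferInstance, IsPGroup.of_bot⟩
  | insert _ _ ih =>
    intro h
    obtain ⟨h1, h2⟩ := ih fun K hK => h K (Set.mem_insert_of_mem _ hK)
    obtain ⟨h3, h4⟩ := h _ (Set.mem_insert _ _)
    rw [sSup_insert]
    exact ⟨Subgroup.sup_normal _ _, h4.to_sup_of_normal_right h2⟩

lemma natCast_card_pCore_ne_zero {p r : ℕ} (hp : p.Prime) (hr : r.Prime) (hpr : r ≠ p)
    (P : Type*) [Group P] [Finite P] (k : Type*) [Field k] [CharP k r] :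
    (Nat.card (pCore p P) : k) ≠ 0 := by
  have := Fact.mk hp
  obtain ⟨n, hn⟩ := IsPGroup.iff_card.mp (isPGroup_pCore p P)
  rw [hn, Ne, CharP.cast_eq_zero_iff k r]
  exact fun h => hpr ((Nat.prime_dvd_prime_iff_eq hr hp).mp (hr.dvd_of_dvd_pow h))

end PCore

/-! ### Harish-Chandra induction as a left adjoint -/

section Adjunction

variable {G : Type v} [Group G] {k : Type u} [Field k] {p : ℕ} {P L : Subgroup G} (hL : L ≤ P)
  (h : Subgroup.IsComplement' (L.subgroupOf P) (pCore p P))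
  {V : Type*} [AddCommGroup V] [Module k V] (X : Representation k L V)
  {M : Type*} [AddCommGroup M] [Module k[G] M]

lemma leviProj_of_mem_pCore {u : P} (hu : u ∈ pCore p P) : leviProj p P L hL h u = 1 := by
  have : QuotientGroup.mk' (pCore p P) u = 1 := (QuotientGroup.eq_one_iff u).mpr hu
  simp only [leviProj, MonoidHom.comp_apply, this, map_one]

lemma leviProj_inclusion (l : L) : leviProj p P L hL h (Subgroup.inclusion hL l) = l := by
  have : h.QuotientMulEquiv (QuotientGroup.mk' (pCore p P) (Subgroup.inclusion hL l)) =
      (Subgroup.subgroupOfEquivOfLe hL).symm l := by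
    rw [← MulEquiv.eq_symm_apply]
    rfl
  simp only [leviProj, MonoidHom.comp_apply, MulEquiv.coe_toMonoidHom, this,
    MulEquiv.apply_symm_apply]

/-- The unit `X → R_{L ⊆ P}^G(X)` of Frobenius reciprocity. -/
def hcIndUnit : V →ₗ[k] (hcInd p P L hL h X).asModule :=
  (hcInd p P L hL h X).asModuleEquiv.symm.toLinearMap ∘ₗ
    Representation.IndV.mk P.subtype (X.comp (leviProj p P L hL h)) 1

lemma single_smul_hcIndUnit (b : P) (x : V) :
    MonoidAlgebra.single (b : G) (1 : k) • hcIndUnit hL h X x =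
      hcIndUnit hL h X (X (leviProj p P L hL h b) x) := by
  have h1 : MonoidAlgebra.single (b : G) (1 : k) • hcIndUnit hL h X x =
      (hcInd p P L hL h X).asModuleEquiv.symm ((hcInd p P L hL h X) b
        (Representation.IndV.mk P.subtype (X.comp (leviProj p P L hL h)) 1 x)) := by
    rw [Representation.asModuleEquiv_symm_map_rho]
    rfl
  rw [h1, hcInd, Representation.ind_mk]
  refine congrArg _ ?_
  -- The coinvariant relation moves `b` from the kG factor to the V factor.
  have := Representation.Coinvariants.mk_inv_tmul
    (ρ := (Representation.leftRegular k G).comp P.subtype)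
    (τ := X.comp (leviProj p P L hL h)) (MonoidAlgebra.single 1 1) x b
  simpa using! this

lemma single_smul_hcIndUnit_of_mem_pCore {b : P} (hb : b ∈ pCore p P) (x : V) :
    MonoidAlgebra.single (b : G) (1 : k) • hcIndUnit hL h X x = hcIndUnit hL h X x := by
  rw [single_smul_hcIndUnit, leviProj_of_mem_pCore hL h hb, map_one, Module.End.one_apply]

lemma single_smul_hcIndUnit_levi (l : L) (x : V) :
    MonoidAlgebra.single (l : G) (1 : k) • hcIndUnit hL h X x = hcIndUnit hL h X (X l x) := by
  have := single_smul_hcIndUnit hL h X (Subgroup.inclusion hL l) x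
  rwa [leviProj_inclusion] at this

lemma hcInd_hom_ext {f g : (hcInd p P L hL h X).asModule →ₗ[k[G]] M}
    (hfg : ∀ x, f (hcIndUnit hL h X x) = g (hcIndUnit hL h X x)) : f = g := by
  let _ : Module k M := Module.restrictScalars k k[G] M
  have : IsScalarTower k k[G] M := IsScalarTower.restrictScalars k k[G] M
  have key : f.restrictScalars k ∘ₗ (hcInd p P L hL h X).asModuleEquiv.symm.toLinearMap =
      g.restrictScalars k ∘ₗ (hcInd p P L hL h X).asModuleEquiv.symm.toLinearMap := by
    refine Representation.IndV.hom_ext _ _ fun y => LinearMap.ext fun x => ?_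
    -- The class of y ⊗ x is the y⁻¹-translate of the unit, so the image of the unit generates the
    -- induced module.
    have h1 : (hcInd p P L hL h X).asModuleEquiv.symm
        (Representation.IndV.mk P.subtype (X.comp (leviProj p P L hL h)) y x) =
        MonoidAlgebra.single y⁻¹ (1 : k) • hcIndUnit hL h X x := by
      have := Representation.ind_mk P.subtype (X.comp (leviProj p P L hL h)) y⁻¹ 1 x
      rw [inv_inv, one_mul] at this
      rw [← this]
      exact (hcInd p P L hL h X).asModuleEquiv_symm_map_rho y⁻¹ _
    change f ((hcInd p P L hL h X).asModuleEquiv.symm (Representation.IndV.mk _ _ y x)) =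
      g ((hcInd p P L hL h X).asModuleEquiv.symm (Representation.IndV.mk _ _ y x))
    rw [h1, map_smul, map_smul, hfg]
  exact LinearMap.ext fun x => LinearMap.congr_fun key x

lemma exists_mul_of_isComplement' {P L : Subgroup G} (hL : L ≤ P)
    (h : Subgroup.IsComplement' (L.subgroupOf P) (pCore p P)) (b : P) :
    ∃ l : L, ∃ c ∈ pCore p P, b = Subgroup.inclusion hL l * c := by
  obtain ⟨⟨l, c⟩, hlc⟩ := h.2 b
  exact ⟨⟨l.1.1, l.2⟩, c.1, c.2, hlc.symm⟩

/-- Frobenius reciprocity for Harish-Chandra induction. -/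
lemma exists_hcInd_lift [Module k M] [IsScalarTower k k[G] M] (φ : V →ₗ[k] M)
    (hφL : ∀ (l : L) x, φ (X l x) = MonoidAlgebra.single (l : G) (1 : k) • φ x)
    (hφU : ∀ c ∈ pCore p P, ∀ x, MonoidAlgebra.single (c : G) (1 : k) • φ x = φ x) :
    ∃ f : (hcInd p P L hL h X).asModule →ₗ[k[G]] M, ∀ x, f (hcIndUnit hL h X x) = φ x := by
  have hφ : ∀ (b : P) x, φ (X (leviProj p P L hL h b) x) =
      MonoidAlgebra.single (b : G) (1 : k) • φ x := fun b x => by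
    obtain ⟨l, c, hc, rfl⟩ := exists_mul_of_isComplement' hL h b
    rw [map_mul, leviProj_inclusion, leviProj_of_mem_pCore hL h hc, mul_one, hφL,
      Subgroup.coe_mul, ← one_mul (1 : k), ← MonoidAlgebra.single_mul_single, one_mul, mul_smul,
      hφU c hc]
    rfl
  let act : G →* Module.End k M :=
    ((Algebra.lsmul k k M : k[G] →ₐ[k] Module.End k M) : k[G] →* Module.End k M).comp
      (MonoidAlgebra.of k G)
  have hact : ∀ g m, act g m = MonoidAlgebra.single g (1 : k) • m := fun _ _ => rfl
  -- The inverse in `act g⁻¹` matches the convention that g ⊗ x stands for g⁻¹ applied to the unit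
  -- at x.
  let F : Representation.IndV P.subtype (X.comp (leviProj p P L hL h)) →ₗ[k] M :=
    Representation.Coinvariants.lift _
      (TensorProduct.lift <| (Finsupp.lift _ _ _ fun g => act g⁻¹ ∘ₗ φ) ∘ₗ
        (MonoidAlgebra.coeffLinearEquiv k).toLinearMap) fun b => by
      ext g x
      simp only [LinearMap.coe_comp, Function.comp_apply, MonoidAlgebra.lsingle_apply]
      simp [Representation.ofMulAction_single, mul_inv_rev, hact, hφ, smul_smul]
  have hF : ∀ g x, F (Representation.IndV.mk P.subtype (X.comp (leviProj p P L hL h)) g x) =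
      MonoidAlgebra.single g⁻¹ (1 : k) • φ x := fun g x => by
    simp [F, hact]
  let F' := MonoidAlgebra.equivariantOfLinearOfComm
    (F ∘ₗ (hcInd p P L hL h X).asModuleEquiv.toLinearMap) fun g v => by
      have key : F ∘ₗ hcInd p P L hL h X g = act g ∘ₗ F := by
        refine Representation.IndV.hom_ext _ _ fun y => LinearMap.ext fun x => ?_
        simp only [LinearMap.comp_apply]
        erw [Representation.ind_mk, hF, hF]
        rw [hact, smul_smul]
        simp
      have := LinearMap.congr_fun key ((hcInd p P L hL h X).asModuleEquiv v)
      simpa [hact] using! this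
  refine ⟨F', fun x => ?_⟩
  have := hF 1 x
  rw [inv_one, ← MonoidAlgebra.one_def, one_smul] at this
  exact this

end Adjunction


/-! ### Extensions of modules -/

section ExtOne

open CategoryTheory

/-- K maps onto M/Q with kernel K ∩ Q, where f vanishes; so f descends to M/Q and is pulled back to
M. -/
lemma LinearMap.exists_extend_of_sup_eq_top {A M Z : Type*} [Ring A] [AddCommGroup M] [Module A M]
    [AddCommGroup Z] [Module A Z] (K Q : Submodule A M) (hKQ : K ⊔ Q = ⊤) (f : K →ₗ[A] Z)
    (hf : ∀ x : K, (x : M) ∈ Q → f x = 0) :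
    ∃ f' : M →ₗ[A] Z, ∀ x : K, f' x = f x := by
  let ψ : K →ₗ[A] M ⧸ Q := Q.mkQ ∘ₗ K.subtype
  have hψ : Function.Surjective ψ := fun y => by
    obtain ⟨m, rfl⟩ := Q.mkQ_surjective y
    obtain ⟨a, ha, b, hb, rfl⟩ := Submodule.mem_sup.mp (hKQ ▸ Submodule.mem_top : m ∈ K ⊔ Q)
    refine ⟨⟨a, ha⟩, ?_⟩
    have hb' : Q.mkQ b = 0 := (Submodule.Quotient.mk_eq_zero Q).mpr hb
    rw [map_add, hb', add_zero]
    rfl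
  have hker : LinearMap.ker ψ ≤ LinearMap.ker f := fun x hx =>
    hf x ((Submodule.Quotient.mk_eq_zero Q).mp hx)
  refine ⟨(LinearMap.ker ψ).liftQ f hker ∘ₗ
    (ψ.quotKerEquivOfSurjective hψ).symm.toLinearMap ∘ₗ Q.mkQ, fun x => ?_⟩
  have : (ψ.quotKerEquivOfSurjective hψ).symm (Q.mkQ x) = (LinearMap.ker ψ).mkQ x := by
    rw [LinearEquiv.symm_apply_eq]
    rfl
  simp only [LinearMap.comp_apply, LinearEquiv.coe_coe, this]
  exact Submodule.liftQ_apply _ _ _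

variable {A : Type w} [Ring A] {R Y Z : Type w} [AddCommGroup R] [Module A R]
  [AddCommGroup Y] [Module A Y] [AddCommGroup Z] [Module A Z]

/-- The short complex `ker π → R → Y`. -/
abbrev kerShortComplex (π : R →ₗ[A] Y) : ShortComplex (ModuleCat.{w} A) :=
  ShortComplex.mk (ModuleCat.ofHom (LinearMap.ker π).subtype) (ModuleCat.ofHom π) <| by
    ext x
    exact x.2

lemma kerShortComplex_shortExact {π : R →ₗ[A] Y} (hπ : Function.Surjective π) :
    (kerShortComplex π).ShortExact where
  exact := by
    rw [ShortComplex.moduleCat_exact_iff]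
    exact fun x hx => ⟨⟨x, hx⟩, rfl⟩
  mono_f := (ModuleCat.mono_iff_injective _).mpr (Submodule.subtype_injective _)
  epi_g := (ModuleCat.epi_iff_surjective _).mpr hπ

/-- For a projective E mapping onto R, every class in Ext¹(R, Z) comes from a homomorphism on the
kernel; it is zero if that homomorphism extends to E. -/
theorem subsingleton_ext_one_of_forall_exists_extend
    (h : ∀ (E : Type w) [AddCommGroup E] [Module A E] (π : E →ₗ[A] R), Function.Surjective π →
      ∀ f : LinearMap.ker π →ₗ[A] Z, ∃ f' : E →ₗ[A] Z, ∀ x : LinearMap.ker π, f' x = f x) :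
    Subsingleton (Abelian.Ext (ModuleCat.of A R) (ModuleCat.of A Z) 1) := by
  refine subsingleton_of_forall_eq 0 fun x => ?_
  let π := Projective.π (ModuleCat.of A R)
  have hπ : Function.Surjective π.hom := (ModuleCat.epi_iff_surjective π).mp inferInstance
  have hS := kerShortComplex_shortExact hπ
  have : Projective (kerShortComplex π.hom).X₂ :=
    inferInstanceAs (Projective (Projective.over (ModuleCat.of A R)))
  obtain ⟨x₁, hx₁⟩ := Abelian.Ext.contravariant_sequence_exact₃ hS (ModuleCat.of A Z) x
    (Abelian.Ext.eq_zero_of_projective _) (add_zero 1)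
  obtain ⟨f, rfl⟩ := (Abelian.Ext.mk₀_bijective _ _).2 x₁
  obtain ⟨f', hf'⟩ := h _ π.hom hπ f.hom
  have hf : f = (kerShortComplex π.hom).f ≫ ModuleCat.ofHom f' := by
    ext x
    exact (hf' x).symm
  rw [← hx₁, hf, ← Abelian.Ext.mk₀_comp_mk₀, hS.extClass_comp_assoc]

lemma ModuleCat.eq_linear_smul {k : Type*} [Field k] [Algebra k A] {M N : ModuleCat.{w} A}
    {f g : M ⟶ N} {c : k} (h : ∀ x, g.hom x = algebraMap k A c • f.hom x) : g = c • f := by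
  ext x
  exact h x

variable (k : Type*) [Field k] [Algebra k A] [Module k Z] [IsScalarTower k A Z]

/-- If `Hom(R, Z) = 0 = Ext¹(R, Z)`, the connecting map `Hom(ker π, Z) → Ext¹(Y, Z)` is an
isomorphism. -/
theorem nonempty_linearMap_ker_equiv_ext_one {π : R →ₗ[A] Y} (hπ : Function.Surjective π)
    (hhom : ∀ f : R →ₗ[A] Z, f = 0)
    (hext : Subsingleton (Abelian.Ext (ModuleCat.of A R) (ModuleCat.of A Z) 1)) :
    Nonempty ((LinearMap.ker π →ₗ[A] Z) ≃ₗ[k]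
      Abelian.Ext (ModuleCat.of A Y) (ModuleCat.of A Z) 1) := by
  have hS := kerShortComplex_shortExact hπ
  let δ : (LinearMap.ker π →ₗ[A] Z) →ₗ[k]
      Abelian.Ext (ModuleCat.of A Y) (ModuleCat.of A Z) 1 :=
    { toFun := fun f => hS.extClass.comp (Abelian.Ext.mk₀ (ModuleCat.ofHom f)) (add_zero 1)
      map_add' := fun f g => by
        rw [ModuleCat.ofHom_add, Abelian.Ext.mk₀_add, Abelian.Ext.comp_add]
      map_smul' := fun c f => by
        rw [ModuleCat.eq_linear_smul (f := ModuleCat.ofHom f) (g := ModuleCat.ofHom (c • f))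
          (c := c) fun x => (algebraMap_smul A c (f x)).symm,
          Abelian.Ext.mk₀_smul, Abelian.Ext.comp_smul, RingHom.id_apply] }
  refine ⟨LinearEquiv.ofBijective δ ⟨?_, ?_⟩⟩
  · rw [injective_iff_map_eq_zero]
    intro f hf
    obtain ⟨x₂, hx₂⟩ := Abelian.Ext.contravariant_sequence_exact₁ hS _
      (Abelian.Ext.mk₀ (ModuleCat.ofHom f)) (add_zero 1) hf
    obtain ⟨g, rfl⟩ := (Abelian.Ext.mk₀_bijective _ _).2 x₂
    have hg : g = 0 := ModuleCat.hom_ext (hhom g.hom)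
    have : ModuleCat.ofHom f = 0 := by
      apply (Abelian.Ext.mk₀_bijective _ _).1
      rw [← hx₂, hg, Abelian.Ext.mk₀_zero, Abelian.Ext.comp_zero, Abelian.Ext.mk₀_zero]
    exact congrArg ModuleCat.Hom.hom this
  · intro x
    obtain ⟨x₁, hx₁⟩ := Abelian.Ext.contravariant_sequence_exact₃ hS (ModuleCat.of A Z) x
      (hext.elim _ _) (add_zero 1)
    obtain ⟨f, rfl⟩ := (Abelian.Ext.mk₀_bijective _ _).2 x₁
    exact ⟨f.hom, hx₁⟩

end ExtOne


/-! ### Harish-Chandra restriction -/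

section Restriction

variable {G : Type v} [Group G] {k : Type u} [Field k] {p : ℕ} {P L : Subgroup G} (hL : L ≤ P)
  {V : Type*} [AddCommGroup V] [Module k V] (X : Representation k L V)
  {M : Type*} [AddCommGroup M] [Module k[G] M]
  {VZ : Type*} [AddCommGroup VZ] [Module k VZ] (Z : Representation k G VZ)

/-- The inclusion of group algebras `kL → kG`. -/
abbrev subgroupAlgebraMap (k : Type u) [Field k] (L : Subgroup G) : k[L] →ₐ[k] k[G] :=
  MonoidAlgebra.mapDomainAlgHom k k L.subtype

/-- The inclusion of `*R_{L ⊆ P}^G(Z)` into `Z`. -/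
def hcResIncl : (hcRes p P L hL Z).asModule →ₗ[k] Z.asModule :=
  Z.asModuleEquiv.symm.toLinearMap ∘ₗ (hcFixed p P Z).subtype ∘ₗ
    (hcRes p P L hL Z).asModuleEquiv.toLinearMap

lemma hcResIncl_injective : Function.Injective (hcResIncl (p := p) hL Z) :=
  Subtype.val_injective

lemma single_smul_hcResIncl (l : L) (z : (hcRes p P L hL Z).asModule) :
    MonoidAlgebra.single (l : G) (1 : k) • hcResIncl hL Z z =
      hcResIncl hL Z (MonoidAlgebra.single l (1 : k) • z) := by
  rw [Representation.single_smul, Representation.single_smul, one_smul, one_smul]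
  rfl

lemma hcResIncl_smul (a : k[L]) (z : (hcRes p P L hL Z).asModule) :
    hcResIncl hL Z (a • z) = subgroupAlgebraMap k L a • hcResIncl hL Z z := by
  induction a using MonoidAlgebra.induction_linear with
  | zero => simp
  | add a b ha hb => rw [add_smul, map_add, ha, hb, map_add, add_smul]
  | single l c =>
    have h1 : MonoidAlgebra.single l c = c • MonoidAlgebra.single l (1 : k) := by simp
    have h2 : subgroupAlgebraMap k L (MonoidAlgebra.single l (1 : k)) =
      MonoidAlgebra.single (l : G) (1 : k) := by simp
    rw [h1, smul_assoc, (hcResIncl hL Z).map_smul, ← single_smul_hcResIncl, map_smul, smul_assoc,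
      h2]

lemma single_smul_hcResIncl_of_mem_pCore {c : P} (hc : c ∈ pCore p P)
    (z : (hcRes p P L hL Z).asModule) :
    MonoidAlgebra.single (c : G) (1 : k) • hcResIncl hL Z z = hcResIncl hL Z z := by
  rw [Representation.single_smul, one_smul]
  exact ((hcRes p P L hL Z).asModuleEquiv z).2 ⟨c, hc⟩

lemma exists_hcResIncl_eq {z : Z.asModule}
    (hz : ∀ c ∈ pCore p P, MonoidAlgebra.single (c : G) (1 : k) • z = z) :
    ∃ y, hcResIncl (p := p) hL Z y = z := by
  refine ⟨(hcRes p P L hL Z).asModuleEquiv.symm ⟨Z.asModuleEquiv z, fun c => ?_⟩, rfl⟩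
  have := hz c.1 c.2
  rwa [Representation.single_smul, one_smul] at this

/-- An `L`-equivariant map into the fixed points of `O_p(P)` is a map into the Harish-Chandra
restriction. -/
lemma exists_linearMap_hcRes (φ : V →ₗ[k] Z.asModule)
    (hφL : ∀ (l : L) x, φ (X l x) = MonoidAlgebra.single (l : G) (1 : k) • φ x)
    (hφU : ∀ c ∈ pCore p P, ∀ x, MonoidAlgebra.single (c : G) (1 : k) • φ x = φ x) :
    ∃ f : X.asModule →ₗ[k[L]] (hcRes p P L hL Z).asModule,
      ∀ x, hcResIncl hL Z (f (X.asModuleEquiv.symm x)) = φ x := by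
  choose y hy using fun x => exists_hcResIncl_eq (p := p) hL Z (z := φ x) fun c hc => hφU c hc x
  let F : V →ₗ[k] (hcRes p P L hL Z).asModule :=
    { toFun := y
      map_add' := fun a b => hcResIncl_injective hL Z (by rw [map_add, hy, hy, hy, map_add])
      map_smul' := fun c a => hcResIncl_injective hL Z (by
        rw [map_smul, hy, hy, map_smul, RingHom.id_apply]) }
  refine ⟨MonoidAlgebra.equivariantOfLinearOfComm (F ∘ₗ X.asModuleEquiv.toLinearMap)
    fun l x => hcResIncl_injective hL Z ?_, hy⟩
  rw [← single_smul_hcResIncl]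
  change hcResIncl hL Z (y (X.asModuleEquiv (MonoidAlgebra.single l (1 : k) • x))) =
    MonoidAlgebra.single (l : G) (1 : k) • hcResIncl hL Z (y (X.asModuleEquiv x))
  rw [hy, hy, ← hφL, Representation.single_smul, one_smul]
  rfl

/-- The fixed points of `O_p(P)` are stable under `P`. -/
lemma single_smul_fixed {m : M}
    (hm : ∀ c ∈ pCore p P, MonoidAlgebra.single (c : G) (1 : k) • m = m) (b : P) :
    ∀ c ∈ pCore p P, MonoidAlgebra.single (c : G) (1 : k) •
      MonoidAlgebra.single (b : G) (1 : k) • m = MonoidAlgebra.single (b : G) (1 : k) • m := by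
  intro c hc
  have h1 : b⁻¹ * c * b ∈ pCore p P := by
    simpa using (pCore_normal p P).conj_mem c hc b⁻¹
  have h2 := hm _ h1
  nth_rewrite 2 [← h2]
  rw [smul_smul, smul_smul, MonoidAlgebra.single_mul_single, MonoidAlgebra.single_mul_single]
  simp [mul_assoc]

lemma subgroupAlgebraMap_smul_fixed (hL : L ≤ P) {m : M}
    (hm : ∀ c ∈ pCore p P, MonoidAlgebra.single (c : G) (1 : k) • m = m) (a : k[L]) :
    ∀ c ∈ pCore p P, MonoidAlgebra.single (c : G) (1 : k) • subgroupAlgebraMap k L a • m =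
      subgroupAlgebraMap k L a • m := by
  intro c hc
  induction a using MonoidAlgebra.induction_linear with
  | zero => simp
  | add a b ha hb => rw [map_add, add_smul, smul_add, ha, hb]
  | single l r =>
    have h1 : subgroupAlgebraMap k L (MonoidAlgebra.single l r) =
        algebraMap k k[G] r * MonoidAlgebra.single (l : G) (1 : k) := by
      simp
    have h2 := single_smul_fixed hm (Subgroup.inclusion hL l) c hc
    rw [h1, mul_smul, ← mul_smul, ← Algebra.commutes, mul_smul]
    exact congrArg _ h2

lemma subgroupAlgebraMap_smul_hcIndUnit
    (h : Subgroup.IsComplement' (L.subgroupOf P) (pCore p P)) (a : k[L]) (x : V) :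
    subgroupAlgebraMap k L a • hcIndUnit hL h X x =
      hcIndUnit hL h X (X.asModuleEquiv (a • X.asModuleEquiv.symm x)) := by
  induction a using MonoidAlgebra.induction_linear with
  | zero => simp
  | add a b ha hb => rw [map_add, add_smul, ha, hb, add_smul, map_add, map_add]
  | single l r =>
    have h1 : MonoidAlgebra.single l r = r • MonoidAlgebra.single l (1 : k) := by simp
    have h2 : subgroupAlgebraMap k L (MonoidAlgebra.single l (1 : k)) =
      MonoidAlgebra.single (l : G) (1 : k) := by simp
    rw [h1, map_smul, smul_assoc, h2, single_smul_hcIndUnit_levi, smul_assoc, map_smul, map_smul,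
      Representation.single_smul, one_smul]
    rfl

/-- Every homomorphism `R(X) → Z` vanishes if `X` is not a composition factor of `*R(Z)`. -/
lemma hcInd_linearMap_eq_zero [IsSimpleModule k[L] X.asModule]
    (hX : ¬ IsCompositionFactor k[L] (hcRes p P L hL Z).asModule X.asModule)
    (h : Subgroup.IsComplement' (L.subgroupOf P) (pCore p P))
    (f : (hcInd p P L hL h X).asModule →ₗ[k[G]] Z.asModule) : f = 0 := by
  obtain ⟨g, hg⟩ := exists_linearMap_hcRes (p := p) hL X Z
    (f.restrictScalars k ∘ₗ hcIndUnit hL h X)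
    (fun l x => by
      simp only [LinearMap.comp_apply, LinearMap.restrictScalars_apply]
      rw [← single_smul_hcIndUnit_levi, map_smul])
    (fun c hc x => by
      simp only [LinearMap.comp_apply, LinearMap.restrictScalars_apply]
      rw [← map_smul, single_smul_hcIndUnit_of_mem_pCore _ _ _ hc])
  have hg0 : g = 0 := by
    -- A nonzero map out of the simple module X would embed it in the restriction of Z.
    refine g.injective_or_eq_zero.resolve_left fun hinj =>
      hX ⟨‹_›, ⊥, LinearMap.range g, bot_le, ⟨?_⟩⟩
    refine (Submodule.quotEquivOfEqBot _ ?_).trans (LinearEquiv.ofInjective g hinj).symm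
    ext x
    simp [Submodule.submoduleOf]
  refine hcInd_hom_ext _ _ _ fun x => ?_
  have := hg x
  rw [hg0, LinearMap.zero_apply, map_zero] at this
  exact this.symm

/-- A nonzero map `X → *R(Z)` gives rise to a nonzero map `R(X) → Z`. -/
lemma exists_hcInd_linearMap_ne_zero (h : Subgroup.IsComplement' (L.subgroupOf P) (pCore p P))
    {f : X.asModule →ₗ[k[L]] (hcRes p P L hL Z).asModule} (hf : f ≠ 0) :
    ∃ F : (hcInd p P L hL h X).asModule →ₗ[k[G]] Z.asModule, F ≠ 0 := by
  obtain ⟨F, hF⟩ := exists_hcInd_lift hL h X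
    (hcResIncl hL Z ∘ₗ f.restrictScalars k ∘ₗ X.asModuleEquiv.symm.toLinearMap)
    (fun l x => by
      simp only [LinearMap.comp_apply, LinearMap.restrictScalars_apply, LinearEquiv.coe_coe]
      rw [Representation.asModuleEquiv_symm_map_rho, map_smul, single_smul_hcResIncl]
      rfl)
    (fun c hc x => single_smul_hcResIncl_of_mem_pCore _ _ hc _)
  refine ⟨F, fun h0 => hf (LinearMap.ext fun x => hcResIncl_injective hL Z ?_)⟩
  have h1 := hF (X.asModuleEquiv x)
  rw [h0, LinearMap.zero_apply] at h1
  rw [LinearMap.zero_apply, map_zero]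
  exact h1.symm

lemma finite_hcRes [FiniteDimensional k VZ] :
    Module.Finite k[L] (hcRes p P L hL Z).asModule :=
  have : Module.Finite k (hcRes p P L hL Z).asModule :=
    inferInstanceAs (Module.Finite k (hcFixed p P Z))
  Module.Finite.of_restrictScalars_finite k _ _

variable [Finite G]

/-- The idempotent of `kG` that projects onto the fixed points of `O_p(P)`. -/
def coreIdempotent (k : Type u) [Field k] (p : ℕ) (P : Subgroup G) : k[G] :=
  letI := Fintype.ofFinite (pCore p P)
  (Nat.card (pCore p P) : k)⁻¹ • ∑ c : pCore p P, MonoidAlgebra.single ((c : P) : G) (1 : k)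

/-- Left translation permutes the summands. The order need not be invertible here: otherwise the
scalar is `0⁻¹ = 0` and both sides vanish. -/
lemma single_smul_coreIdempotent_smul (m : M) : ∀ c ∈ pCore p P,
    MonoidAlgebra.single (c : G) (1 : k) • coreIdempotent k p P • m =
      coreIdempotent k p P • m := by
  intro c hc
  rw [smul_smul]
  congr 1
  rw [coreIdempotent, mul_smul_comm, Finset.mul_sum]
  let _ := Fintype.ofFinite (pCore p P)
  refine congrArg _ ?_
  refine Fintype.sum_equiv (Equiv.mulLeft ⟨c, hc⟩) _ _ fun d => ?_
  rw [MonoidAlgebra.single_mul_single, one_mul]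
  rfl

lemma coreIdempotent_smul_of_fixed (hk : (Nat.card (pCore p P) : k) ≠ 0) {m : M}
    (hm : ∀ c ∈ pCore p P, MonoidAlgebra.single (c : G) (1 : k) • m = m) :
    coreIdempotent k p P • m = m := by
  let _ := Fintype.ofFinite (pCore p P)
  have h1 : coreIdempotent k p P = algebraMap k k[G] (Nat.card (pCore p P) : k)⁻¹ *
      ∑ c : pCore p P, MonoidAlgebra.single ((c : P) : G) (1 : k) := Algebra.smul_def _ _
  rw [h1, mul_smul, Finset.sum_smul, Finset.sum_congr rfl fun c _ => hm c.1 c.2,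
    Finset.sum_const, Finset.card_univ, ← Nat.card_eq_fintype_card,
    ← Nat.cast_smul_eq_nsmul k[G], smul_smul, ← map_natCast (algebraMap k k[G]), ← map_mul,
    inv_mul_cancel₀ hk, map_one, one_smul]

/-- If an element of the centre of `kL` acts as `1` on `X` and as `0` on `*R(Z)`, then every
homomorphism to `Z` from the kernel of a surjection `E → R(X)` extends to `E`. -/
theorem exists_extend_of_ker_hcInd
    (h : Subgroup.IsComplement' (L.subgroupOf P) (pCore p P))
    (hk : (Nat.card (pCore p P) : k) ≠ 0) (a : k[L]) (ha : ∀ b : k[L], a * b = b * a)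
    (haX : ∀ x : X.asModule, a • x = x) (haZ : ∀ z : (hcRes p P L hL Z).asModule, a • z = 0)
    (π : M →ₗ[k[G]] (hcInd p P L hL h X).asModule) (hπ : Function.Surjective π)
    (f : LinearMap.ker π →ₗ[k[G]] Z.asModule) :
    ∃ f' : M →ₗ[k[G]] Z.asModule, ∀ x : LinearMap.ker π, f' x = f x := by
  let _ : Module k M := Module.restrictScalars k k[G] M
  have : IsScalarTower k k[G] M := IsScalarTower.restrictScalars k k[G] M
  obtain ⟨σ, hσ⟩ := (π.restrictScalars k).exists_rightInverse_of_surjective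
    (LinearMap.range_eq_top.mpr hπ)
  let ℓ : V →ₗ[k] M := σ ∘ₗ hcIndUnit hL h X
  have hℓ : ∀ x, π (ℓ x) = hcIndUnit hL h X x := fun x => LinearMap.congr_fun hσ _
  have heℓ : ∀ x, π (coreIdempotent k p P • ℓ x) = hcIndUnit hL h X x := fun x => by
    rw [map_smul, hℓ, coreIdempotent_smul_of_fixed hk fun c hc =>
      single_smul_hcIndUnit_of_mem_pCore hL h X hc x]
  let θ := subgroupAlgebraMap k L
  -- Averaging makes the lift fixed by O_p(P), and `a` will repair its L-equivariance; neither
  -- changes the image under `π`, since the unit is fixed by O_p(P) and `a` acts as 1 on X.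
  let φ : V →ₗ[k] M := Algebra.lsmul k k M (θ a * coreIdempotent k p P) ∘ₗ ℓ
  have hφ : ∀ x, φ x = θ a • coreIdempotent k p P • ℓ x := fun x => mul_smul _ _ _
  have hπφ : ∀ x, π (φ x) = hcIndUnit hL h X x := fun x => by
    rw [hφ, map_smul, heℓ, subgroupAlgebraMap_smul_hcIndUnit, haX]
    rfl
  -- M/N is an extension of R(X) by the image of `f`; it suffices to split it.
  let N : Submodule k[G] M := (LinearMap.ker f).map (LinearMap.ker π).subtype
  have hNπ : N ≤ LinearMap.ker π := by
    rintro _ ⟨y, -, rfl⟩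
    exact y.2
  -- For such `d` the value f(d) is fixed by O_p(P), hence killed by `a`.
  have hN : ∀ d : M, π d = 0 →
      (∀ c ∈ pCore p P, MonoidAlgebra.single (c : G) (1 : k) • d = d) → θ a • d ∈ N := by
    intro d hd hdU
    refine ⟨θ a • ⟨d, hd⟩, ?_, rfl⟩
    obtain ⟨z, hz⟩ := exists_hcResIncl_eq (p := p) hL Z (z := f ⟨d, hd⟩) fun c hc => by
      rw [← map_smul]
      exact congrArg f (Subtype.ext (hdU c hc))
    rw [SetLike.mem_coe, LinearMap.mem_ker, map_smul, ← hz, ← hcResIncl_smul, haZ, map_zero]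
  obtain ⟨F, hF⟩ := exists_hcInd_lift hL h X ((N.mkQ.restrictScalars k) ∘ₗ φ)
    (fun l x => by
      have h1 : θ (MonoidAlgebra.single l (1 : k)) = MonoidAlgebra.single (l : G) (1 : k) := by
        simp [θ]
      -- The equivariance defect of the averaged lift is fixed by O_p(P) and lies in ker π, so `a`
      -- sends it into N; centrality lets `a` pass `l`.
      have h2 : MonoidAlgebra.single (l : G) (1 : k) • φ x - φ (X l x) ∈ N := by
        have := hN (MonoidAlgebra.single (l : G) (1 : k) • coreIdempotent k p P • ℓ x -
          coreIdempotent k p P • ℓ (X l x)) (by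
            rw [map_sub, map_smul, heℓ, heℓ, single_smul_hcIndUnit_levi, sub_self]) (by
            intro c hc
            rw [smul_sub, single_smul_coreIdempotent_smul _ c hc]
            congr 1
            exact single_smul_fixed (single_smul_coreIdempotent_smul (ℓ x))
              (Subgroup.inclusion hL l) c hc)
        rwa [smul_sub, ← hφ, smul_smul, ← h1, ← map_mul, ha, map_mul, mul_smul, ← hφ, h1] at this
      have h3 := (Submodule.Quotient.mk_eq_zero N).mpr h2
      rw [Submodule.Quotient.mk_sub, sub_eq_zero] at h3
      exact h3.symm)
    (fun c hc x => by
      have : MonoidAlgebra.single (c : G) (1 : k) • φ x = φ x := by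
        rw [hφ]
        exact subgroupAlgebraMap_smul_fixed hL (single_smul_coreIdempotent_smul _) a c hc
      exact congrArg N.mkQ this)
  have hsec : (N.liftQ π hNπ) ∘ₗ F = LinearMap.id := hcInd_hom_ext hL h X fun x => by
    rw [LinearMap.comp_apply, hF]
    exact hπφ x
  -- Q is the preimage in M of the image of the section `F`; it spans M together with ker π and
  -- meets ker π only in N, where `f` vanishes.
  refine LinearMap.exists_extend_of_sup_eq_top (LinearMap.ker π) ((LinearMap.range F).comap N.mkQ)
    ?_ f ?_
  · refine eq_top_iff.mpr fun m _ => ?_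
    obtain ⟨m', hm'⟩ := N.mkQ_surjective (F (π m))
    have h1 : π m' = π m := by
      have : N.liftQ π hNπ (N.mkQ m') = π m := by
        rw [hm']
        exact LinearMap.congr_fun hsec (π m)
      exact this
    rw [← sub_add_cancel m m']
    refine Submodule.add_mem_sup ?_ ⟨π m, hm'.symm⟩
    rw [LinearMap.mem_ker, map_sub, h1, sub_self]
  · rintro x ⟨y, hy⟩
    have h1 : y = 0 := by
      have h2 := congrArg (N.liftQ π hNπ) hy
      have h3 := LinearMap.congr_fun hsec y
      exact h3.symm.trans (h2.trans x.2)
    rw [h1, map_zero] at hy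
    obtain ⟨x', hx', hxx'⟩ := (Submodule.Quotient.mk_eq_zero N).mp hy.symm
    rwa [← Subtype.ext (a1 := x') hxx']

end Restriction

/-! ### The principal series -/

namespace SplitBNPair

variable {p : ℕ} {G : Type v} [Group G] (D : SplitBNPair p G) {k : Type u} [Field k]
  {VX : Type*} [AddCommGroup VX] [Module k VX] (X : Representation k D.T VX)
  {VZ : Type*} [AddCommGroup VZ] [Module k VZ] (Z : Representation k G VZ)

lemma conj_mem_T {n t : G} (hn : n ∈ D.N) (ht : t ∈ D.T) : n * t * n⁻¹ ∈ D.T :=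
  D.torus_normal.conj_mem ⟨t, ht.2⟩ ht ⟨n, hn⟩

/-- T = B ∩ n₀Bn₀⁻¹ lies in a standard parabolic and in its opposite, and N normalizes T. Hence the
minimality condition is vacuous for the principal series. -/
lemma T_le_of_isLeviPair {P L : Subgroup G} (h : D.IsLeviPair P L) : D.T ≤ L := by
  obtain ⟨J, -, n₀, ⟨hn₀, hB⟩, n, hn, -, rfl⟩ := h
  intro t ht
  have h1 : n⁻¹ * t * n ∈ D.T := by
    simpa using D.conj_mem_T (D.N.inv_mem hn) ht
  refine ⟨n⁻¹ * t * n, ⟨?_, ?_⟩, by simp [mul_assoc]⟩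
  · exact (le_sup_left : D.B ≤ D.genOver D.B J) h1.1
  · rw [← hB] at h1
    exact (le_sup_left : conjSubgroup n₀ D.B ≤ D.genOver (conjSubgroup n₀ D.B) J) h1.2

lemma inPrincipalSeries_of_isCompositionFactor (hZ : Z.IsIrreducible)
    (h : IsCompositionFactor k[D.T] (hcRes p D.B D.T D.T_le_B Z).asModule X.asModule) :
    D.InPrincipalSeries X Z := by
  refine ⟨hZ, fun hbot => ?_, fun P' L' hPL hlt => ?_, h⟩
  · obtain ⟨hX, M₁, M₂, -, ⟨e⟩⟩ := h
    have : Nontrivial X.asModule := IsSimpleModule.nontrivial k[D.T] _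
    have h1 : Subsingleton (hcFixed p D.B Z) := by
      rw [hbot]; infer_instance
    have h2 : Subsingleton (hcRes p D.B D.T D.T_le_B Z).asModule := h1
    obtain ⟨x, hx⟩ := exists_ne (0 : X.asModule)
    obtain ⟨y, hy⟩ := Submodule.mkQ_surjective _ (e.symm x)
    rw [Subsingleton.elim y 0, map_zero] at hy
    exact hx (e.symm.injective (hy.symm.trans (map_zero _).symm))
  · exact absurd (D.T_le_of_isLeviPair hPL) hlt.not_ge

lemma torusAlgebra_mul_comm (a b : k[D.T]) : a * b = b * a := by
  let _ : CommGroup D.T :=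
    { (inferInstance : Group D.T) with
      mul_comm := fun s t => Subtype.ext (D.torus_comm s s.2 t t.2) }
  exact mul_comm a b

variable [Finite G]

/-- A member of the principal series is a quotient of `R_T^G(X)`. -/
lemma exists_surjective_R [FiniteDimensional k VZ] (hZ : Z.IsIrreducible)
    (h : IsCompositionFactor k[D.T] (hcRes p D.B D.T D.T_le_B Z).asModule X.asModule) :
    ∃ f : D.R X →ₗ[k[G]] Z.asModule, Function.Surjective f := by
  have hfin := finite_hcRes (p := p) D.T_le_B Z
  have hart : IsArtinianRing k[D.T] := isArtinian_of_tower k inferInstance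
  -- Commutativity of T enters here: it puts X, a mere composition factor of the fixed points,
  -- inside them as a submodule.
  let _ : CommRing k[D.T] :=
    { (inferInstance : Ring k[D.T]) with mul_comm := D.torusAlgebra_mul_comm }
  obtain ⟨f, hf⟩ := exists_linearMap_injective_of_isCompositionFactor h
  have : Nontrivial X.asModule := have := h.1; IsSimpleModule.nontrivial k[D.T] _
  obtain ⟨F, hF⟩ := exists_hcInd_linearMap_ne_zero D.T_le_B X Z D.split (f := f) (by
    rintro rfl
    obtain ⟨x, hx⟩ := exists_ne (0 : X.asModule)
    exact hx (hf rfl))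
  exact ⟨F, F.surjective_or_eq_zero.resolve_right hF⟩

/-- `Ext¹(R_T^G(X), Z) = 0` if `X` is not a composition factor of `Z^U`. -/
lemma subsingleton_extOne_R {G : Type v} [Group G] [Finite G] (D : SplitBNPair p G)
    {k : Type u} [Field k] (hk : (Nat.card (pCore p D.B) : k) ≠ 0)
    {VX : Type (max u v)} [AddCommGroup VX] [Module k VX] (X : Representation k D.T VX)
    [IsSimpleModule k[D.T] X.asModule]
    {VZ : Type (max u v)} [AddCommGroup VZ] [Module k VZ] [FiniteDimensional k VZ]
    (Z : Representation k G VZ)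
    (h : ¬ IsCompositionFactor k[D.T] (hcRes p D.B D.T D.T_le_B Z).asModule X.asModule) :
    Subsingleton (ExtOne k G (D.R X) Z.asModule) := by
  have hfin := finite_hcRes (p := p) D.T_le_B Z
  obtain ⟨a, haZ, haX⟩ : ∃ a : k[D.T],
      (∀ z : (hcRes p D.B D.T D.T_le_B Z).asModule, a • z = 0) ∧ ∀ x : X.asModule, a • x = x := by
    let _ : CommRing k[D.T] :=
      { (inferInstance : Ring k[D.T]) with mul_comm := D.torusAlgebra_mul_comm }
    exact exists_annihilator_of_not_isCompositionFactor h
  exact subsingleton_ext_one_of_forall_exists_extend fun E _ _ π hπ f =>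
    exists_extend_of_ker_hcInd D.T_le_B X Z D.split hk a (D.torusAlgebra_mul_comm a) haX haZ π hπ f

end SplitBNPair

lemma finiteDimensional_hcInd {G : Type v} [Group G] [Finite G] {k : Type u} [Field k] {p : ℕ}
    {P L : Subgroup G} (hL : L ≤ P) (h : Subgroup.IsComplement' (L.subgroupOf P) (pCore p P))
    {V : Type*} [AddCommGroup V] [Module k V] [FiniteDimensional k V] (X : Representation k L V) :
    FiniteDimensional k (hcInd p P L hL h X).asModule :=
  Module.Finite.of_surjective
    ((hcInd p P L hL h X).asModuleEquiv.symm.toLinearMap ∘ₗ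
      Representation.Coinvariants.mk (Representation.tprod
        ((Representation.leftRegular k G).comp P.subtype) (X.comp (leviProj p P L hL h))))
    ((hcInd p P L hL h X).asModuleEquiv.symm.surjective.comp
      (Representation.Coinvariants.mk_surjective _))

lemma isSimpleModule_asModule_of_finrank_eq_one {G k V : Type*} [Group G] [Field k]
    [AddCommGroup V] [Module k V] (X : Representation k G V) (hX : Module.finrank k V = 1) :
    IsSimpleModule k[G] X.asModule := by
  have hX' : Module.finrank k X.asModule = 1 := hX
  have : IsSimpleModule k X.asModule := isSimpleModule_iff_finrank_eq_one.mpr hX'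
  have : Nontrivial X.asModule := IsSimpleModule.nontrivial k _
  refine isSimpleModule_iff_toSpanSingleton_surjective.mpr ⟨inferInstance, fun x hx y => ?_⟩
  obtain ⟨c, hc⟩ := IsSimpleModule.toSpanSingleton_surjective k hx y
  exact ⟨algebraMap k k[G] c, (algebraMap_smul k[G] c x).trans hc⟩

end

theorem theorem4p1 {p r : ℕ} (hp : p.Prime) (hr : r.Prime) (hpr : r ≠ p)
    {G : Type v} [Group G] [Finite G] (D : SplitBNPair p G)
    {k : Type u} [Field k] [IsAlgClosed k] [CharP k r]
    {VX : Type (max u v)} [AddCommGroup VX] [Module k VX] (X : Representation k D.T VX)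
    (hX : Module.finrank k VX = 1)
    {VY : Type (max u v)} [AddCommGroup VY] [Module k VY] [FiniteDimensional k VY]
    (Y : Representation k G VY) (hY : D.InPrincipalSeries X Y)
    {VZ : Type (max u v)} [AddCommGroup VZ] [Module k VZ] [FiniteDimensional k VZ]
    (Z : Representation k G VZ) (hZ : Z.IsIrreducible) (hZX : ¬ D.InPrincipalSeries X Z) :
    Subsingleton (ExtOne k G (D.R X) Z.asModule) ∧
    (∃ L₀ : Submodule k[G] (D.R X), Nonempty ((D.R X ⧸ L₀) ≃ₗ[k[G]] Y.asModule)) ∧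
    ∀ L₀ : Submodule k[G] (D.R X), Nonempty ((D.R X ⧸ L₀) ≃ₗ[k[G]] Y.asModule) →
      FiniteDimensional k (ExtOne k G Y.asModule Z.asModule) ∧
      Module.finrank k (ExtOne k G Y.asModule Z.asModule) =
        compositionMultiplicity k[G] (ModuleHead k[G] L₀) Z.asModule := by
  have hsimple : IsSimpleModule k[D.T] X.asModule := isSimpleModule_asModule_of_finrank_eq_one X hX
  have hXZ : ¬ IsCompositionFactor k[D.T] (hcRes p D.B D.T D.T_le_B Z).asModule X.asModule :=
    fun h => hZX (D.inPrincipalSeries_of_isCompositionFactor X Z hZ h)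
  have hext := D.subsingleton_extOne_R (natCast_card_pCore_ne_zero hp hr hpr D.B k) X Z hXZ
  refine ⟨hext, ?_, ?_⟩
  · obtain ⟨f, hf⟩ := D.exists_surjective_R X Y hY.1 hY.2.2.2
    exact ⟨LinearMap.ker f, ⟨f.quotKerEquivOfSurjective hf⟩⟩
  · rintro L₀ ⟨e⟩
    have : FiniteDimensional k VX := Module.finite_of_finrank_eq_succ hX
    have : FiniteDimensional k (D.R X) := finiteDimensional_hcInd D.T_le_B D.split X
    have : FiniteDimensional k L₀ := finiteDimensional_submodule k L₀
    -- Any given `L₀` is the kernel of such a surjection, so the argument does not depend on its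
    -- choice.
    let π : D.R X →ₗ[k[G]] Y.asModule := e.toLinearMap ∘ₗ L₀.mkQ
    have hker : LinearMap.ker π = L₀ := by
      rw [LinearMap.ker_comp_of_ker_eq_bot _ e.ker, Submodule.ker_mkQ]
    obtain ⟨δ⟩ := nonempty_linearMap_ker_equiv_ext_one k (π := π) (Z := Z.asModule)
      (e.surjective.comp L₀.mkQ_surjective)
      (fun f => hcInd_linearMap_eq_zero D.T_le_B X Z hXZ D.split f) hext
    let δ' := (LinearEquiv.congrLeft Z.asModule k (LinearEquiv.ofEq _ _ hker)).symm.trans δ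
    exact ⟨Module.Finite.equiv δ',
      by rw [← δ'.finrank_eq, compositionMultiplicity_moduleHead k]⟩
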